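/- Let $(X,d)$ be a metric space with bounded geometry: for every $r>0$ the cardinalities of the balls $B(x,r)$, $x\in X$, are uniformly bounded (so $X$ is discrete). For $k:X\times X\to\mathbb C$ and $t\ge 0$ put $\|k\|_{BS,t}=\big(\sup_{y\in X}\sum_{x\in X}|k(x,y)|^2(1+d(x,y))^{2t}\big)^{1/2}\in[0,\infty]$ and $\|k\|_{BS^*,t}=\max\{\|k\|_{BS,t},\|k^*\|_{BS,t}\}$, where $k^*(x,y)=\overline{k(y,x)}$. Let $BS_2(X)$ be the set of all $k$ with $\|k\|_{BS^*,t}<\infty$ for every $t\ge0$. Let $C^*_u(X)\subset\mathbb B(\ell^2(X))$ be the uniform Roe algebra, i.e. the $C^*$-algebra generated by the operators whose matrices are bounded and of finite propagation ($\sup\{d(x,y):k(x,y)\neq0\}<\infty$). Say that $X$ has property (MRD) if $BS_2(X)\subset C^*_u(X)$, i.e. every $k\in BS_2(X)$ is the matrix of an operator in $C^*_u(X)$. Let $E_r=\{(x,y)\in X\times X:d(x,y)\le r\}$, and let $\mathcal G(X)=\bigcup_{r\ge0}\overline{E_r}\subset\beta(X\times X)$ be the coarse groupoid of $X$: the étale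 groupoid whose structure maps are the continuous extensions of those of the pair groupoid $X\times X$ (range $(x,y)\mapsto x$, source $(x,y)\mapsto y$). Let $\ell:\mathcal G(X)\to[0,\infty)$ be the continuous extension of $d$, which is a length function on $\mathcal G(X)$. For an étale groupoid $\mathcal G$ with unit space $\mathcal G^{(0)}$, source fibres $\mathcal G_x=\{\gamma\in\mathcal G:s(\gamma)=x\}$ and a length function $\ell$, and for $f\in C_c(\mathcal G)$, put $f^*(\gamma)=\overline{f(\gamma^{-1})}$, $$\|f\|_{\ell,t,s}=\sup_{x\in\mathcal G^{(0)}}\Big(\sum_{\gamma\in\mathcal G_x}|f(\gamma)|^2(1+\ell(\gamma))^{2t}\Big)^{1/2},\qquad \|f\|_{\ell,t}=\max\{\|f\|_{\ell,t,s},\|f^*\|_{\ell,t,s}\},$$ and let $\|f\|_{C^*_r\mathcal G}=\sup_{x\in\mathcal G^{(0)}}\|\lambda_x(f)\|_{\mathbb B(\ell^2\mathcal G_x)}$, where $[\lambda_x(f)\xi](\gamma)=\sum_{\eta\in\mathcal G_x}f(\gamma\eta^{-1})\xi(\eta)$. Say that $\mathcal G$ has property (RD) with respect to $\ell$ if there are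 constants $C,t\ge0$ such that $\|f\|_{C^*_r\mathcal G}\le C\|f\|_{\ell,t}$ for all $f\in C_c(\mathcal G)$. Then: if $X$ has property (MRD), the coarse groupoid $\mathcal G(X)$ has property (RD) with respect to $\ell$. -/

import Mathlib

namespace CoarseRD

open Filter Topology Set
open scoped ENNReal ComplexConjugate CompactlySupported

universe u

noncomputable section

/-! ### Étale groupoids, length functions and property (RD) -/

/-- An étale groupoid, described by its space of arrows `G`. An object is identified with its
identity arrow, so `src` and `rng` take values in `G` and the unit space is the range of `src`.
The product `mul γ σ` is defined when `src γ = rng σ`. The topology is locally compact Hausdorff,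
the structure maps are continuous, and the source map onto the unit space is a local
homeomorphism. -/
class EtaleGroupoid (G : Type u) [TopologicalSpace G] where
  src : G → G
  rng : G → G
  inv : G → G
  mul : (γ σ : G) → src γ = rng σ → G
  src_src : ∀ γ, src (src γ) = src γ
  rng_src : ∀ γ, rng (src γ) = src γ
  src_rng : ∀ γ, src (rng γ) = rng γ
  rng_rng : ∀ γ, rng (rng γ) = rng γ
  src_inv : ∀ γ, src (inv γ) = rng γ
  rng_inv : ∀ γ, rng (inv γ) = src γ
  src_mul : ∀ γ σ h, src (mul γ σ h) = src σ
  rng_mul : ∀ γ σ h, rng (mul γ σ h) = rng γ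
  mul_assoc : ∀ γ σ τ (h₁ : src γ = rng σ) (h₂ : src σ = rng τ),
    mul (mul γ σ h₁) τ ((src_mul γ σ h₁).trans h₂) =
      mul γ (mul σ τ h₂) (h₁.trans (rng_mul σ τ h₂).symm)
  mul_src : ∀ γ, mul γ (src γ) (rng_src γ).symm = γ
  rng_mul_self : ∀ γ, mul (rng γ) γ (src_rng γ) = γ
  mul_inv : ∀ γ, mul γ (inv γ) (rng_inv γ).symm = rng γ
  inv_mul : ∀ γ, mul (inv γ) γ (src_inv γ) = src γ
  t2 : T2Space G
  locallyCompact : LocallyCompactSpace G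
  continuous_src : Continuous src
  continuous_rng : Continuous rng
  continuous_inv : Continuous inv
  continuous_mul : Continuous fun p : {p : G × G // src p.1 = rng p.2} => mul p.1.1 p.1.2 p.2
  isLocalHomeomorph_src : IsLocalHomeomorph (Set.rangeFactorization src)

section Groupoid

variable {G : Type u} [TopologicalSpace G] [EtaleGroupoid G]

open EtaleGroupoid

variable (G) in
/-- The unit space. -/
def unitSpace : Set G := Set.range (src : G → G)

/-- The source fibre at `x`. -/
def SourceFiber (x : G) : Type u := {γ : G // src γ = x}

/-- The arrow `γ η⁻¹` for `γ`, `η` in the same source fibre. -/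
def mulInv {x : G} (γ η : SourceFiber x) : G :=
  mul γ.1 (inv η.1) ((γ.2.trans η.2.symm).trans (rng_inv η.1).symm)

variable (G) in
/-- A length function on a groupoid. -/
structure LengthFunction where
  toFun : G → ℝ
  nonneg : ∀ γ, 0 ≤ toFun γ
  unit : ∀ x ∈ unitSpace G, toFun x = 0
  inv : ∀ γ, toFun (inv γ) = toFun γ
  mul_le : ∀ γ σ h, toFun (mul γ σ h) ≤ toFun γ + toFun σ

/-- The involution `f^*(γ) = conj (f (γ⁻¹))`. -/
def involution (f : G → ℂ) : G → ℂ := fun γ => conj (f (inv γ))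

/-- The left regular representation at `x`:
`[λ_x(f) ξ](γ) = ∑_{η ∈ G_x} f(γ η⁻¹) ξ(η)` (for `f ∈ C_c(G)` a sum with finitely many
nonzero terms). -/
def leftRegular (f : G → ℂ) (x : G) (ξ : SourceFiber x → ℂ) : SourceFiber x → ℂ :=
  fun γ => ∑' η : SourceFiber x, f (mulInv γ η) * ξ η

/-- The `ℓ²`-norm of an arbitrary function, with values in `[0, ∞]`. -/
def l2norm {ι : Type u} (v : ι → ℂ) : ℝ≥0∞ := (∑' i, ‖v i‖ₑ ^ 2) ^ (1 / 2 : ℝ)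

/-- The operator norm of `λ_x(f)` on `ℓ²(G_x)`, with values in `[0, ∞]`. -/
def leftRegularNorm (f : G → ℂ) (x : G) : ℝ≥0∞ :=
  ⨆ (ξ : lp (fun _ : SourceFiber x => ℂ) 2) (_ : ‖ξ‖ ≤ 1), l2norm (leftRegular f x ξ)

/-- The reduced `C^*`-norm: the supremum over the unit space of the norms of `λ_x(f)`. -/
def reducedNorm (f : G → ℂ) : ℝ≥0∞ := ⨆ x ∈ unitSpace G, leftRegularNorm f x

/-- The seminorm `‖f‖_{ℓ,t,s,x} = (∑_{γ ∈ G_x} |f(γ)|² (1 + ℓ(γ))^{2t})^{1/2}`. -/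
def fiberNorm (ℓ : LengthFunction G) (t : ℝ) (f : G → ℂ) (x : G) : ℝ≥0∞ :=
  (∑' γ : SourceFiber x,
    ‖f γ.1‖ₑ ^ 2 * ENNReal.ofReal ((1 + ℓ.toFun γ.1) ^ (2 * t))) ^ (1 / 2 : ℝ)

/-- The seminorm `‖f‖_{ℓ,t,s} = sup_x ‖f‖_{ℓ,t,s,x}`. -/
def sourceNorm (ℓ : LengthFunction G) (t : ℝ) (f : G → ℂ) : ℝ≥0∞ :=
  ⨆ x ∈ unitSpace G, fiberNorm ℓ t f x

/-- The norm `‖f‖_{ℓ,t} = max (‖f‖_{ℓ,t,s}, ‖f^*‖_{ℓ,t,s})`. -/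
def lengthNorm (ℓ : LengthFunction G) (t : ℝ) (f : G → ℂ) : ℝ≥0∞ :=
  max (sourceNorm ℓ t f) (sourceNorm ℓ t (involution f))

/-- Property (RD) of an étale groupoid with respect to a length function. -/
def HasRD (ℓ : LengthFunction G) : Prop :=
  ∃ C t : ℝ, 0 ≤ C ∧ 0 ≤ t ∧
    ∀ f : C_c(G, ℂ), reducedNorm (f : G → ℂ) ≤ ENNReal.ofReal C * lengthNorm ℓ t (f : G → ℂ)

end Groupoid

/-! ### Bounded geometry and metric rapid decay -/

/-- Bounded geometry: balls of a given radius have uniformly bounded cardinality.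
(In particular, balls are finite, so the topology is discrete.) -/
class BoundedGeometry (X : Type u) [MetricSpace X] : Prop where
  bound : ∀ r : ℝ, 0 < r → ∃ N : ℕ, ∀ x : X, (Metric.closedBall x r).encard ≤ N

section Metric

variable (X : Type u) [MetricSpace X]

/-- The Hilbert space `ℓ²(X)`. -/
abbrev L2 : Type u := lp (fun _ : X => ℂ) 2

variable {X}

open Classical in
/-- The bounded operator `T` on `ℓ²(X)` has the matrix `k`: `⟨δ_x, T δ_y⟩ = k (x, y)`. -/
def HasMatrix (T : L2 X →L[ℂ] L2 X) (k : X × X → ℂ) : Prop :=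
  ∀ x y : X, (T (lp.single 2 y (1 : ℂ)) : X → ℂ) x = k (x, y)

/-- The propagation of `k`, with values in `[0, ∞]`. -/
def propagation (k : X × X → ℂ) : ℝ≥0∞ := ⨆ (x : X) (y : X) (_ : k (x, y) ≠ 0), edist x y

variable (X)

/-- `ℂ_u(X)`: the bounded functions on `X × X` of finite propagation. -/
def finitePropagation : Set (X × X → ℂ) :=
  {k | (∃ M : ℝ, ∀ p, ‖k p‖ ≤ M) ∧ propagation k < ∞}

/-- The uniform Roe algebra: the `C^*`-subalgebra of the bounded operators on `ℓ²(X)` generated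
by the operators whose matrices are in `ℂ_u(X)`. -/
def uniformRoe : StarSubalgebra ℂ (L2 X →L[ℂ] L2 X) :=
  (StarAlgebra.adjoin ℂ {T | ∃ k ∈ finitePropagation X, HasMatrix T k}).topologicalClosure

variable {X}

/-- `‖k‖_{BS,t} = (sup_y ∑_x |k(x,y)|² (1 + d(x,y))^{2t})^{1/2}`. -/
def bsNorm (t : ℝ) (k : X × X → ℂ) : ℝ≥0∞ :=
  (⨆ y : X, ∑' x : X, ‖k (x, y)‖ₑ ^ 2 * ENNReal.ofReal ((1 + dist x y) ^ (2 * t))) ^ (1 / 2 : ℝ)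

/-- `k^*(x, y) = conj (k (y, x))`. -/
def kernelStar (k : X × X → ℂ) : X × X → ℂ := fun p => conj (k (p.2, p.1))

/-- `‖k‖_{BS^*,t} = max (‖k‖_{BS,t}, ‖k^*‖_{BS,t})`. -/
def bsStarNorm (t : ℝ) (k : X × X → ℂ) : ℝ≥0∞ := max (bsNorm t k) (bsNorm t (kernelStar k))

variable (X)

/-- `BS_2(X)`: the functions `k` on `X × X` with `‖k‖_{BS^*,t} < ∞` for all `t ≥ 0`. -/
def BS2 : Set (X × X → ℂ) := {k | ∀ t : ℝ, 0 ≤ t → bsStarNorm t k < ∞}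

/-- Property (MRD): `BS_2(X)` is contained in the uniform Roe algebra, that is, each of its
elements is the matrix of an operator in that algebra. -/
def HasMRD : Prop := ∀ k ∈ BS2 X, ∃ T ∈ uniformRoe X, HasMatrix T k

end Metric

/-! ### The coarse groupoid -/

section Coarse

variable (X : Type u) [MetricSpace X]

/-- The tube of radius `r`. -/
def tube (r : ℝ) : Set (X × X) := {p | dist p.1 p.2 ≤ r}

/-- The coarse groupoid as a set: the union of the closures of the tubes in the Stone–Čech
compactification of the discrete space `X × X` (its space of ultrafilters, in which a point `p`
is the principal ultrafilter `pure p`). -/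
def coarseSet : Set (Ultrafilter (X × X)) :=
  ⋃ r : {r : ℝ // 0 ≤ r}, closure ((pure : X × X → Ultrafilter (X × X)) '' tube X r)

/-- The space of the coarse groupoid. Its topology is the one of an (open) subspace of the
Stone–Čech compactification of `X × X`. -/
abbrev CoarseGroupoid : Type u := coarseSet X

variable {X}

theorem mem_closure_pure {α : Type u} {s : Set α} {ω : Ultrafilter α} :
    ω ∈ closure ((pure : α → Ultrafilter α) '' s) ↔ s ∈ ω := by
  constructor
  · intro h
    have h1 : closure ((pure : α → Ultrafilter α) '' s) ⊆ {u : Ultrafilter α | s ∈ u} := by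
      refine closure_minimal ?_ (ultrafilter_isClosed_basic s)
      rintro _ ⟨a, ha, rfl⟩
      exact ha
    exact h1 h
  · intro h
    rw [ultrafilterBasis_is_basis.mem_closure_iff]
    rintro _ ⟨a, rfl⟩ ha
    obtain ⟨x, hx⟩ := ω.nonempty_of_mem (inter_mem ha h)
    exact ⟨pure x, hx.1, x, hx.2, rfl⟩

theorem mem_coarseSet {ω : Ultrafilter (X × X)} : ω ∈ coarseSet X ↔ ∃ r : ℝ, tube X r ∈ ω := by
  simp only [coarseSet, mem_iUnion, mem_closure_pure]
  constructor
  · rintro ⟨r, hr⟩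
    exact ⟨r, hr⟩
  · rintro ⟨r, hr⟩
    exact ⟨⟨max r 0, le_max_right _ _⟩,
      mem_of_superset hr fun p (hp : dist p.1 p.2 ≤ r) => hp.trans (le_max_left _ _)⟩

theorem isOpen_coarseSet : IsOpen (coarseSet X) := by
  have : coarseSet X = ⋃ r : ℝ, {ω : Ultrafilter (X × X) | tube X r ∈ ω} := by
    ext ω
    rw [mem_coarseSet, mem_iUnion]
    rfl
  rw [this]
  exact isOpen_iUnion fun r => ultrafilter_isOpen_basic _

theorem continuous_ultrafilter_map {α β : Type u} (f : α → β) :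
    Continuous (Ultrafilter.map f) := by
  refine ultrafilterBasis_is_basis.continuous_iff.2 ?_
  rintro _ ⟨s, rfl⟩
  exact ultrafilter_isOpen_basic (f ⁻¹' s)

theorem ultrafilter_map_congr {α β : Type u} {f g : α → β} {ω : Ultrafilter α}
    (h : ∀ᶠ a in (ω : Filter α), f a = g a) : ω.map f = ω.map g :=
  Ultrafilter.coe_injective (Filter.map_congr h)

namespace CoarseGroupoid

/-- The range map on `X × X`, extended to ultrafilters; units are carried by the diagonal. -/
def rng (γ : CoarseGroupoid X) : CoarseGroupoid X :=
  ⟨γ.1.map fun p => (p.1, p.1), mem_coarseSet.2 ⟨0, by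
    refine Ultrafilter.mem_map.2 (Filter.univ_mem' fun p => ?_)
    simp [tube]⟩⟩

/-- The source map on `X × X`, extended to ultrafilters. -/
def src (γ : CoarseGroupoid X) : CoarseGroupoid X :=
  ⟨γ.1.map fun p => (p.2, p.2), mem_coarseSet.2 ⟨0, by
    refine Ultrafilter.mem_map.2 (Filter.univ_mem' fun p => ?_)
    simp [tube]⟩⟩

/-- The inverse on `X × X`, extended to ultrafilters. -/
def inv (γ : CoarseGroupoid X) : CoarseGroupoid X :=
  ⟨γ.1.map Prod.swap, by
    obtain ⟨r, hr⟩ := mem_coarseSet.1 γ.2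
    refine mem_coarseSet.2 ⟨r, Ultrafilter.mem_map.2 (mem_of_superset hr fun p hp => ?_)⟩
    simpa [tube, dist_comm] using hp⟩

/-- The point `(x, y)` with `x, y ∈ X` as an arrow of the coarse groupoid. -/
def ofPair (x y : X) : CoarseGroupoid X :=
  ⟨pure (x, y), mem_coarseSet.2 ⟨dist x y, show dist x y ≤ dist x y from le_rfl⟩⟩

theorem src_val (γ : CoarseGroupoid X) : (src γ).1 = γ.1.map fun p => (p.2, p.2) := rfl

theorem eventually_snd_of_eq {γ σ : CoarseGroupoid X} (h : src γ = rng σ) {P : X → Prop}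
    (hP : ∀ᶠ p in (γ.1 : Filter (X × X)), P p.2) : ∀ᶠ p in (σ.1 : Filter (X × X)), P p.1 := by
  have h1 : {q : X × X | P q.1} ∈ (src γ).1 := Ultrafilter.mem_map.2 hP
  rw [h] at h1
  exact Ultrafilter.mem_map.1 h1

/-- By bounded geometry, near an arrow `γ` the first coordinate is a function of the second. -/
theorem exists_section [BoundedGeometry X] (γ : CoarseGroupoid X) :
    ∃ t : X → X, ∀ᶠ p in (γ.1 : Filter (X × X)), p.1 = t p.2 := by
  classical
  obtain ⟨r, hr⟩ := mem_coarseSet.1 γ.2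
  obtain ⟨N, hN⟩ := BoundedGeometry.bound (X := X) (max r 1) (by positivity)
  have hfin : ∀ y : X, (Metric.closedBall y (max r 1)).Finite := fun y =>
    Set.finite_of_encard_le_coe (hN y)
  have hcol : ∀ y : X, ∃ e : X → Fin (N + 1), Set.InjOn e (Metric.closedBall y (max r 1)) := by
    intro y
    have hle : (Metric.closedBall y (max r 1)).encard ≤ (Set.univ : Set (Fin (N + 1))).encard := by
      rw [Set.encard_univ]
      refine (hN y).trans ?_
      simp
    obtain ⟨e, -, he⟩ := (hfin y).exists_injOn_of_encard_le hle
    exact ⟨e, he⟩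
  choose e he using hcol
  have hex : ∃ i : Fin (N + 1), ∀ᶠ p in (γ.1 : Filter (X × X)), e p.2 p.1 = i := by
    have := (Ultrafilter.eventually_exists_iff (f := γ.1)
      (P := fun (i : Fin (N + 1)) (p : X × X) => e p.2 p.1 = i)).1
      (Filter.Eventually.of_forall fun p => ⟨_, rfl⟩)
    exact this
  obtain ⟨i, hi⟩ := hex
  refine ⟨fun y => if h : ∃ x, dist x y ≤ r ∧ e y x = i then h.choose else y, ?_⟩
  filter_upwards [hr, hi] with p hp hpi
  have h : ∃ x, dist x p.2 ≤ r ∧ e p.2 x = i := ⟨p.1, hp, hpi⟩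
  rw [dif_pos h]
  refine he p.2 ?_ ?_ (hpi.trans h.choose_spec.2.symm)
  · exact (show dist p.1 p.2 ≤ r from hp).trans (le_max_left _ _)
  · exact h.choose_spec.1.trans (le_max_left _ _)

/-- The extension of the metric `d : X × X → [0, ∞)` to the coarse groupoid: the limit of `d` along
an ultrafilter. The limit exists, see `tendsto_dist`. -/
def len (γ : CoarseGroupoid X) : ℝ := limUnder (γ.1 : Filter (X × X)) fun p => dist p.1 p.2

theorem tendsto_dist (γ : CoarseGroupoid X) :
    Tendsto (fun p : X × X => dist p.1 p.2) (γ.1 : Filter (X × X)) (𝓝 (len γ)) := by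
  obtain ⟨r, hr⟩ := mem_coarseSet.1 γ.2
  have h1 : Set.Icc 0 r ∈ γ.1.map fun p : X × X => dist p.1 p.2 :=
    Ultrafilter.mem_map.2 (mem_of_superset hr fun p hp => ⟨dist_nonneg, hp⟩)
  obtain ⟨a, -, ha⟩ := (isCompact_Icc (a := (0 : ℝ)) (b := r)).ultrafilter_le_nhds _
    (le_principal_iff.2 h1)
  exact tendsto_nhds_limUnder ⟨a, ha⟩

theorem len_ofPair (x y : X) : len (ofPair x y) = dist x y :=
  tendsto_nhds_unique (tendsto_dist (ofPair x y)) (tendsto_pure_nhds _ (x, y))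

theorem continuous_len : Continuous (len : CoarseGroupoid X → ℝ) := by
  rw [continuous_iff_continuousAt]
  intro γ₀
  rw [ContinuousAt, (nhds_basis_uniformity Metric.uniformity_basis_dist_le).tendsto_right_iff]
  intro ε hε
  have hA : {p : X × X | dist (dist p.1 p.2) (len γ₀) ≤ ε} ∈ γ₀.1 :=
    tendsto_dist γ₀ (Metric.closedBall_mem_nhds _ hε)
  have hU : IsOpen {γ : CoarseGroupoid X |
      {p : X × X | dist (dist p.1 p.2) (len γ₀) ≤ ε} ∈ γ.1} :=
    (ultrafilter_isOpen_basic _).preimage continuous_subtype_val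
  filter_upwards [hU.mem_nhds hA] with γ hγ
  exact Metric.isClosed_closedBall.mem_of_tendsto (tendsto_dist γ) hγ

variable [BoundedGeometry X]

/-- A map `t` with `x = t y` for `γ`-almost all pairs `(x, y)`. -/
def translation (γ : CoarseGroupoid X) : X → X := (exists_section γ).choose

theorem translation_spec (γ : CoarseGroupoid X) :
    ∀ᶠ p in (γ.1 : Filter (X × X)), p.1 = translation γ p.2 := (exists_section γ).choose_spec

/-- The product: if `γ` is carried by pairs `(t y, y)` and `σ` by pairs `(y, z)`, then `γ σ` is
carried by the pairs `(t y, z) = (t y, y) (y, z)`. It does not depend on the choice of `t`, see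
`mul_val_eq`, and is the continuous extension of the product of the pair groupoid, see
`mul_ofPair` and the instance below. -/
def mul (γ σ : CoarseGroupoid X) (h : src γ = rng σ) : CoarseGroupoid X :=
  ⟨σ.1.map fun p => (translation γ p.1, p.2), by
    obtain ⟨r, hr⟩ := mem_coarseSet.1 γ.2
    obtain ⟨r', hr'⟩ := mem_coarseSet.1 σ.2
    have h1 : ∀ᶠ p in (γ.1 : Filter (X × X)), dist (translation γ p.2) p.2 ≤ r := by
      filter_upwards [hr, translation_spec γ] with p hp hpt
      rw [← hpt]
      exact hp
    have h2 := eventually_snd_of_eq h (P := fun y => dist (translation γ y) y ≤ r) h1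
    refine mem_coarseSet.2 ⟨r + r', Ultrafilter.mem_map.2 ?_⟩
    filter_upwards [h2, hr'] with p hp hp'
    exact (dist_triangle _ p.1 _).trans (add_le_add hp hp')⟩

theorem mul_val_eq (γ σ : CoarseGroupoid X) (h : src γ = rng σ) (t : X → X)
    (ht : ∀ᶠ p in (γ.1 : Filter (X × X)), p.1 = t p.2) :
    (mul γ σ h).1 = σ.1.map fun p => (t p.1, p.2) := by
  have h1 : ∀ᶠ p in (γ.1 : Filter (X × X)), translation γ p.2 = t p.2 := by
    filter_upwards [ht, translation_spec γ] with p hp hp'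
    exact hp'.symm.trans hp
  refine ultrafilter_map_congr ?_
  filter_upwards [eventually_snd_of_eq h (P := fun y => translation γ y = t y) h1] with p hp
  rw [hp]

theorem mul_ofPair (x y z : X) (h : src (ofPair x y) = rng (ofPair y z)) :
    mul (ofPair x y) (ofPair y z) h = ofPair x z := by
  refine Subtype.ext ?_
  rw [mul_val_eq _ _ h (fun _ => x) (Filter.eventually_pure.2 rfl)]
  rfl

theorem isLocalHomeomorph_src :
    IsLocalHomeomorph (Set.rangeFactorization (src : CoarseGroupoid X → CoarseGroupoid X)) := by
  rw [isLocalHomeomorph_iff_isOpenEmbedding_restrict]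
  intro γ₀
  set t := translation γ₀ with ht
  obtain ⟨r, hr⟩ := mem_coarseSet.1 γ₀.2
  set U : Set (CoarseGroupoid X) := {γ | tube X r ∩ {p | p.1 = t p.2} ∈ γ.1} with hU
  have hUo : IsOpen U := (ultrafilter_isOpen_basic _).preimage continuous_subtype_val
  have hUm : γ₀ ∈ U := inter_mem hr (translation_spec γ₀)
  have hsrc : Continuous (src : CoarseGroupoid X → CoarseGroupoid X) :=
    ((continuous_ultrafilter_map _).comp continuous_subtype_val).subtype_mk _
  have hcont : Continuous (Set.rangeFactorization
      (src : CoarseGroupoid X → CoarseGroupoid X)) := hsrc.subtype_mk _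
  -- an arrow in `U` is recovered from its source
  have hrec : ∀ γ ∈ U, γ.1 = (src γ).1.map fun p => (t p.2, p.2) := by
    intro γ hγ
    rw [src_val, Ultrafilter.map_map]
    conv_lhs => rw [← Ultrafilter.map_id γ.1]
    refine ultrafilter_map_congr ?_
    filter_upwards [hγ] with p hp
    exact Prod.ext hp.2 rfl
  refine ⟨U, hUo.mem_nhds hUm, ?_⟩
  refine IsOpenEmbedding.of_continuous_injective_isOpenMap
    (hcont.comp continuous_subtype_val) ?_ ?_
  · rintro ⟨γ, hγ⟩ ⟨σ, hσ⟩ h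
    have h' : src γ = src σ := congrArg Subtype.val h
    refine Subtype.ext (Subtype.ext ?_)
    show γ.1 = σ.1
    rw [hrec γ hγ, hrec σ hσ, h']
  · intro V hV
    obtain ⟨V₁, hV₁, rfl⟩ := isOpen_induced_iff.1 hV
    obtain ⟨V₂, hV₂, rfl⟩ := isOpen_induced_iff.1 hV₁
    refine isOpen_induced_iff.2 ⟨Subtype.val ⁻¹'
      (Ultrafilter.map (fun p : X × X => (t p.2, p.2)) ⁻¹'
        (V₂ ∩ {ω | tube X r ∩ {p | p.1 = t p.2} ∈ ω})), ?_, ?_⟩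
    · exact ((hV₂.inter (ultrafilter_isOpen_basic _)).preimage
        (continuous_ultrafilter_map _)).preimage continuous_subtype_val
    · ext ⟨ω, hω⟩
      constructor
      · rintro ⟨h1, h2⟩
        have hmem : (ω.1.map fun p : X × X => (t p.2, p.2)) ∈ coarseSet X :=
          mem_coarseSet.2 ⟨r, mem_of_superset h2 inter_subset_left⟩
        refine ⟨⟨⟨_, hmem⟩, h2⟩, h1, ?_⟩
        refine Subtype.ext (Subtype.ext ?_)
        show (ω.1.map fun p : X × X => (t p.2, p.2)).map (fun p => (p.2, p.2)) = ω.1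
        obtain ⟨γ, rfl⟩ := hω
        rw [src_val, Ultrafilter.map_map, Ultrafilter.map_map]
        rfl
      · rintro ⟨⟨γ, hγ⟩, h1, h2⟩
        have h3 : src γ = ω := congrArg Subtype.val h2
        have h4 := hrec γ hγ
        rw [h3] at h4
        refine ⟨?_, ?_⟩
        · show (ω.1.map fun p : X × X => (t p.2, p.2)) ∈ V₂
          rw [← h4]
          exact h1
        · show _ ∈ (ω.1.map fun p : X × X => (t p.2, p.2))
          rw [← h4]
          exact hγ

theorem continuous_mul : Continuous
    fun p : {p : CoarseGroupoid X × CoarseGroupoid X // src p.1 = rng p.2} =>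
      mul p.1.1 p.1.2 p.2 := by
  rw [continuous_iff_continuousAt]
  rintro ⟨⟨γ₀, σ₀⟩, h₀⟩
  set t := translation γ₀ with ht
  refine IsInducing.subtypeVal.continuousAt_iff.2 ?_
  have hc : Continuous fun p : {p : CoarseGroupoid X × CoarseGroupoid X // src p.1 = rng p.2} =>
      p.1.2.1.map fun q : X × X => (t q.1, q.2) :=
    (continuous_ultrafilter_map _).comp
      (continuous_subtype_val.comp (continuous_snd.comp continuous_subtype_val))
  refine hc.continuousAt.congr ?_
  have hU : IsOpen {p : {p : CoarseGroupoid X × CoarseGroupoid X // src p.1 = rng p.2} |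
      {q : X × X | q.1 = t q.2} ∈ p.1.1.1} :=
    (ultrafilter_isOpen_basic _).preimage
      (continuous_subtype_val.comp (continuous_fst.comp continuous_subtype_val))
  filter_upwards [hU.mem_nhds (translation_spec γ₀)] with p hp
  exact (mul_val_eq p.1.1 p.1.2 p.2 t hp).symm

theorem rng_mul (γ σ : CoarseGroupoid X) (h : src γ = rng σ) : rng (mul γ σ h) = rng γ := by
  refine Subtype.ext ?_
  have h1 : (rng γ).1 = (src γ).1.map fun p => (translation γ p.1, translation γ p.1) := by
    rw [src_val, Ultrafilter.map_map]
    refine ultrafilter_map_congr ?_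
    filter_upwards [translation_spec γ] with p hp
    simp [hp]
  rw [h1, h]
  rfl

theorem mul_assoc (γ σ τ : CoarseGroupoid X) (h₁ : src γ = rng σ) (h₂ : src σ = rng τ) :
    mul (mul γ σ h₁) τ h₂ = mul γ (mul σ τ h₂) (h₁.trans (rng_mul σ τ h₂).symm) := by
  refine Subtype.ext ?_
  rw [mul_val_eq (mul γ σ h₁) τ h₂ (fun z => translation γ (translation σ z))]
  · rfl
  · refine Filter.eventually_map.2 ?_
    filter_upwards [translation_spec σ] with p hp
    rw [← hp]

theorem mul_src (γ : CoarseGroupoid X) : mul γ (src γ) rfl = γ := by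
  refine Subtype.ext ?_
  conv_rhs => rw [← Ultrafilter.map_id γ.1]
  refine (Ultrafilter.map_map γ.1 _ _).trans (ultrafilter_map_congr ?_)
  filter_upwards [translation_spec γ] with p hp
  exact Prod.ext hp.symm rfl

theorem rng_mul_self (γ : CoarseGroupoid X) : mul (rng γ) γ rfl = γ := by
  refine Subtype.ext ?_
  rw [mul_val_eq (rng γ) γ rfl id (Filter.eventually_map.2 (Filter.Eventually.of_forall
    fun _ => rfl))]
  exact Ultrafilter.map_id γ.1

theorem mul_inv (γ : CoarseGroupoid X) : mul γ (inv γ) rfl = rng γ := by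
  refine Subtype.ext ?_
  refine (Ultrafilter.map_map γ.1 _ _).trans (ultrafilter_map_congr ?_)
  filter_upwards [translation_spec γ] with p hp
  exact Prod.ext hp.symm rfl

theorem inv_mul (γ : CoarseGroupoid X) : mul (inv γ) γ rfl = src γ := by
  refine Subtype.ext (ultrafilter_map_congr ?_)
  filter_upwards [Filter.eventually_map.1 (translation_spec (inv γ))] with p hp
  exact Prod.ext hp.symm rfl

/-- The pair groupoid structure of `X × X`, extended to the coarse groupoid. -/
instance : EtaleGroupoid (CoarseGroupoid X) where
  src := src
  rng := rng
  inv := inv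
  mul := mul
  src_src _ := rfl
  rng_src _ := rfl
  src_rng _ := rfl
  rng_rng _ := rfl
  src_inv _ := rfl
  rng_inv _ := rfl
  src_mul _ _ _ := rfl
  rng_mul := rng_mul
  mul_assoc := mul_assoc
  mul_src := mul_src
  rng_mul_self := rng_mul_self
  mul_inv := mul_inv
  inv_mul := inv_mul
  t2 := inferInstance
  locallyCompact := isOpen_coarseSet.locallyCompactSpace
  continuous_src := ((continuous_ultrafilter_map _).comp continuous_subtype_val).subtype_mk _
  continuous_rng := ((continuous_ultrafilter_map _).comp continuous_subtype_val).subtype_mk _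
  continuous_inv := ((continuous_ultrafilter_map _).comp continuous_subtype_val).subtype_mk _
  continuous_mul := continuous_mul
  isLocalHomeomorph_src := isLocalHomeomorph_src

variable (X) in
/-- The canonical length function on the coarse groupoid: the continuous extension of the metric
(see `continuous_len` and `len_ofPair`). -/
def canonicalLength : LengthFunction (CoarseGroupoid X) where
  toFun := len
  nonneg γ := ge_of_tendsto' (tendsto_dist γ) fun _ => dist_nonneg
  unit := by
    rintro _ ⟨γ, rfl⟩
    refine tendsto_nhds_unique (tendsto_dist _) (tendsto_map'_iff.2 ?_)
    simp [Function.comp_def]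
  inv γ := by
    refine tendsto_nhds_unique (tendsto_dist _) (tendsto_map'_iff.2 ?_)
    simpa [Function.comp_def, dist_comm] using tendsto_dist γ
  mul_le γ σ h := by
    have h2 := tendsto_map'_iff.1 (tendsto_dist (mul γ σ h))
    have h3 : Tendsto (fun p : X × X => dist (translation γ p.2) p.2) (γ.1 : Filter (X × X))
        (𝓝 (len γ)) := by
      refine (tendsto_dist γ).congr' ?_
      filter_upwards [translation_spec γ] with p hp
      rw [← hp]
    have h4 : Tendsto (fun p : X × X => dist (translation γ p.1) p.1) (σ.1 : Filter (X × X))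
        (𝓝 (len γ)) := by
      have h5 : Tendsto (fun p : X × X => dist (translation γ p.1) p.1)
          ((src γ).1 : Filter (X × X)) (𝓝 (len γ)) := tendsto_map'_iff.2 h3
      rw [show src γ = rng σ from h] at h5
      exact tendsto_map'_iff.1 h5
    exact le_of_tendsto_of_tendsto' h2 (h4.add (tendsto_dist σ)) fun p => dist_triangle _ _ _

end CoarseGroupoid

end Coarse

end

end CoarseRD

namespace CoarseRD

open Filter Topology Set
open scoped ENNReal ComplexConjugate CompactlySupported

universe u v

/-! ### `ℓ²`-bounds for finite sections of kernels -/

section Kernel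

variable {X : Type u}

/-! The proof has a metric half and a groupoid half, joined by `MatrixBound`, which bounds the
finite sections of |k|. Absolute values cost nothing, since the `BS` norms see only |k|.

Metric half: (MRD), a mere inclusion of sets, already forces an estimate by 4^n ‖k‖_{BS*,n} for some
n (`HasMRD.exists_matrixBound`). This is a gliding hump argument. If every n fails, choose k_n with
‖k_n‖_{BS*,n} ≤ 1 that violates the bound 4^n on a finite set F_n, and cut k_n off to F_n × F_n.
Then K = (∑ 4^{-n}|k_n|²)^{1/2} lies in BS_2(X), so it is the matrix of a bounded operator T. Since
|k_n| ≤ 2^n K, it follows that 4^n < 2^n ‖T‖ for all n, which is absurd.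

Groupoid half: restrict f to the kernel k(x,y) = f(x,y) on X × X. Each arrow γ with source ω is the
limit along ω of pairs (t_γ(y), y), so f(γη⁻¹) is the limit of k(t_γ(y), t_η(y)), and distinct
arrows have t_γ(y) ≠ t_η(y) for ω-almost all y. Hence finite sections of λ_ω(f) are limits of finite
sections of k and obey the same bound (`reducedNorm_le`). Finally ‖k‖_{BS*,t} ≤ ‖f‖_{ℓ,t}, because
the points of X are among the units (`bsStarNorm_le_lengthNorm`). -/

/-- The finite sections of the kernel `|k|` are bounded by `B` on `ℓ²`. -/
def MatrixBound (k : X × X → ℂ) (B : ℝ≥0∞) : Prop :=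
  ∀ (F : Finset X) (a : X → ℂ),
    ∑ x ∈ F, (∑ y ∈ F, ‖k (x, y)‖ₑ * ‖a y‖ₑ) ^ 2 ≤ B ^ 2 * ∑ y ∈ F, ‖a y‖ₑ ^ 2

theorem MatrixBound.of_le_mul {k K : X × X → ℂ} {B c : ℝ≥0∞} (hK : MatrixBound K B)
    (h : ∀ p, ‖k p‖ₑ ≤ c * ‖K p‖ₑ) : MatrixBound k (c * B) := by
  intro F a
  calc ∑ x ∈ F, (∑ y ∈ F, ‖k (x, y)‖ₑ * ‖a y‖ₑ) ^ 2
      ≤ ∑ x ∈ F, (∑ y ∈ F, c * ‖K (x, y)‖ₑ * ‖a y‖ₑ) ^ 2 := by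
        gcongr with x _ y _
        exact h _
    _ = c ^ 2 * ∑ x ∈ F, (∑ y ∈ F, ‖K (x, y)‖ₑ * ‖a y‖ₑ) ^ 2 := by
        simp only [_root_.mul_assoc, ← Finset.mul_sum, mul_pow]
    _ ≤ c ^ 2 * (B ^ 2 * ∑ y ∈ F, ‖a y‖ₑ ^ 2) := by gcongr; exact hK F a
    _ = _ := by ring

/-- A bound on finite sections transfers along an injective reindexing. -/
theorem MatrixBound.sum_comp_le {k : X × X → ℂ} {B : ℝ≥0∞} (hk : MatrixBound k B)
    {ι : Type v} (F : Finset ι) (τ : ι → X) (hτ : Set.InjOn τ F) (a : ι → ℂ) :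
    ∑ i ∈ F, (∑ j ∈ F, ‖k (τ i, τ j)‖ₑ * ‖a j‖ₑ) ^ 2 ≤ B ^ 2 * ∑ j ∈ F, ‖a j‖ₑ ^ 2 := by
  classical
  rcases F.eq_empty_or_nonempty with rfl | ⟨i₀, -⟩
  · simp
  have : Nonempty ι := ⟨i₀⟩
  -- The vector is moved to X by a left inverse of τ on F; `Function.invFunOn` needs `Nonempty ι`,
  -- hence the case split.
  have h := hk (F.image τ) fun x => a (Function.invFunOn τ F x)
  rw [Finset.sum_image hτ, Finset.sum_image hτ] at h
  simp only [Finset.sum_image hτ] at h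
  have hinv : ∀ j ∈ F, Function.invFunOn τ F (τ j) = j := fun j hj =>
    hτ.leftInvOn_invFunOn hj
  refine le_of_eq_of_le (Finset.sum_congr rfl fun i _ => ?_) (h.trans_eq ?_)
  · congr 1
    exact Finset.sum_congr rfl fun j hj => by rw [hinv j hj]
  · congr 1
    exact Finset.sum_congr rfl fun j hj => by rw [hinv j hj]

theorem tsum_enorm_sq_lp (ξ : lp (fun _ : X => ℂ) 2) : ∑' x, ‖ξ x‖ₑ ^ 2 = ‖ξ‖ₑ ^ 2 := by
  have h : HasSum (fun x => ‖ξ x‖ ^ 2) (‖ξ‖ ^ 2) := by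
    simpa using lp.hasSum_norm (p := 2) (by norm_num) ξ
  have h' := ENNReal.ofReal_tsum_of_nonneg (fun x => sq_nonneg ‖ξ x‖) h.summable
  rw [h.tsum_eq] at h'
  simpa [ENNReal.ofReal_pow, ofReal_norm] using h'.symm

/-- Since K ≥ 0, applying T to the vector |a| on F produces no cancellation: the entries of the
image are exactly the sums in `MatrixBound`. -/
theorem matrixBound_of_hasMatrix [MetricSpace X] {T : L2 X →L[ℂ] L2 X} {K : X × X → ℂ}
    (hT : HasMatrix T K) (hK : ∀ p, K p = (‖K p‖ : ℂ)) : MatrixBound K ‖T‖ₑ := by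
  classical
  intro F a
  set v : L2 X := ∑ y ∈ F, (‖a y‖ : ℂ) • lp.single 2 y (1 : ℂ) with hv
  have hv_apply : ∀ x, v x = if x ∈ F then (‖a x‖ : ℂ) else 0 := by
    intro x
    rw [hv, lp.coeFn_sum, Finset.sum_apply]
    simp only [lp.coeFn_smul, Pi.smul_apply, lp.single_apply, smul_eq_mul]
    simp [Pi.single_apply]
  have hTv : ∀ x, T v x = ∑ y ∈ F, K (x, y) * ‖a y‖ := by
    intro x
    rw [hv, map_sum, lp.coeFn_sum, Finset.sum_apply]
    refine Finset.sum_congr rfl fun y _ => ?_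
    rw [map_smul, lp.coeFn_smul, Pi.smul_apply, smul_eq_mul, _root_.mul_comm]
    congr 1
    convert hT x y
  have hTv_enorm : ∀ x, ‖T v x‖ₑ = ∑ y ∈ F, ‖K (x, y)‖ₑ * ‖a y‖ₑ := by
    intro x
    have h1 : T v x = ((∑ y ∈ F, ‖K (x, y)‖ * ‖a y‖ : ℝ) : ℂ) := by
      rw [hTv]
      push_cast
      exact Finset.sum_congr rfl fun y _ => by rw [← hK]
    rw [h1, ← ofReal_norm, Complex.norm_real, Real.norm_of_nonneg (by positivity),
      ENNReal.ofReal_sum_of_nonneg fun _ _ => by positivity]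
    refine Finset.sum_congr rfl fun y _ => ?_
    rw [ENNReal.ofReal_mul (norm_nonneg _), ofReal_norm, ofReal_norm]
  have hv_norm : ‖v‖ₑ ^ 2 = ∑ y ∈ F, ‖a y‖ₑ ^ 2 := by
    rw [← tsum_enorm_sq_lp, tsum_eq_sum (s := F) fun x hx => by simp [hv_apply, hx]]
    refine Finset.sum_congr rfl fun y hy => ?_
    rw [hv_apply, if_pos hy, ← ofReal_norm, Complex.norm_real, norm_norm, ofReal_norm]
  calc ∑ x ∈ F, (∑ y ∈ F, ‖K (x, y)‖ₑ * ‖a y‖ₑ) ^ 2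
      = ∑ x ∈ F, ‖T v x‖ₑ ^ 2 := by simp only [hTv_enorm]
    _ ≤ ‖T v‖ₑ ^ 2 := by
        rw [← tsum_enorm_sq_lp]
        exact ENNReal.sum_le_tsum F
    _ ≤ (‖T‖ₑ * ‖v‖ₑ) ^ 2 := by
        gcongr
        exact T.le_opENorm v
    _ = _ := by rw [mul_pow, hv_norm]

end Kernel

/-! ### The norm estimate implied by metric rapid decay -/

section RapidDecay

variable {X : Type u} [MetricSpace X]

theorem bsNorm_le_iff {t : ℝ} {k : X × X → ℂ} {b : ℝ≥0∞} :
    bsNorm t k ≤ b ↔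
      ∀ y, ∑' x, ‖k (x, y)‖ₑ ^ 2 * ENNReal.ofReal ((1 + dist x y) ^ (2 * t)) ≤ b ^ 2 := by
  rw [bsNorm, one_div, ENNReal.rpow_inv_le_iff two_pos, ENNReal.rpow_two, iSup_le_iff]

theorem bsNorm_le_mul {t : ℝ} {k K : X × X → ℂ} {c : ℝ≥0∞} (h : ∀ p, ‖k p‖ₑ ≤ c * ‖K p‖ₑ) :
    bsNorm t k ≤ c * bsNorm t K := by
  rw [bsNorm_le_iff]
  intro y
  calc _ ≤ ∑' x, c ^ 2 * (‖K (x, y)‖ₑ ^ 2 * ENNReal.ofReal ((1 + dist x y) ^ (2 * t))) := by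
        refine ENNReal.tsum_le_tsum fun x => ?_
        rw [← _root_.mul_assoc, ← mul_pow]
        gcongr
        exact h _
    _ = c ^ 2 * _ := ENNReal.tsum_mul_left
    _ ≤ c ^ 2 * bsNorm t K ^ 2 := by
        gcongr
        exact bsNorm_le_iff.1 le_rfl y
    _ = _ := (mul_pow _ _ _).symm

theorem bsNorm_mono {s t : ℝ} (hst : s ≤ t) (k : X × X → ℂ) : bsNorm s k ≤ bsNorm t k := by
  rw [bsNorm_le_iff]
  intro y
  refine le_trans (ENNReal.tsum_le_tsum fun x => ?_) (bsNorm_le_iff.1 le_rfl y)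
  gcongr
  exact le_add_of_nonneg_right dist_nonneg

theorem enorm_le_bsNorm {t : ℝ} (ht : 0 ≤ t) (k : X × X → ℂ) (p : X × X) :
    ‖k p‖ₑ ≤ bsNorm t k := by
  refine le_trans ?_ (bsNorm_mono ht k)
  refine (ENNReal.pow_le_pow_left_iff two_ne_zero).1 ?_
  refine le_trans ?_ (bsNorm_le_iff.1 le_rfl p.2)
  refine le_trans ?_ (ENNReal.le_tsum p.1)
  simp

theorem enorm_kernelStar {X : Type u} (k : X × X → ℂ) (p : X × X) : ‖kernelStar k p‖ₑ = ‖k p.swap‖ₑ := by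
  rw [kernelStar, RCLike.enorm_conj]
  rfl

theorem bsStarNorm_le_mul {t : ℝ} {k K : X × X → ℂ} {c : ℝ≥0∞}
    (h : ∀ p, ‖k p‖ₑ ≤ c * ‖K p‖ₑ) : bsStarNorm t k ≤ c * bsStarNorm t K := by
  refine max_le ((bsNorm_le_mul h).trans ?_) ((bsNorm_le_mul (c := c) (K := kernelStar K) ?_).trans ?_)
  · gcongr
    exact le_max_left _ _
  · intro p
    rw [enorm_kernelStar, enorm_kernelStar]
    exact h _
  · gcongr
    exact le_max_right _ _

/-- A hump is controlled a priori only in its own norm; cutting it off to a finite square makes all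
its other norms finite. -/
theorem bsNorm_lt_top_of_finite_support {k : X × X → ℂ} (F : Finset X)
    (hk : ∀ x y, ¬(x ∈ F ∧ y ∈ F) → k (x, y) = 0) (t : ℝ) : bsNorm t k < ∞ := by
  set S := ∑ y ∈ F, ∑ x ∈ F, ‖k (x, y)‖ₑ ^ 2 * ENNReal.ofReal ((1 + dist x y) ^ (2 * t)) with hS
  have hfin : S < ∞ := by
    refine ENNReal.sum_lt_top.2 fun y _ => ENNReal.sum_lt_top.2 fun x _ => ?_
    exact ENNReal.mul_lt_top (ENNReal.pow_lt_top enorm_lt_top) ENNReal.ofReal_lt_top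
  refine ENNReal.rpow_lt_top_of_nonneg (by norm_num) (ne_of_lt (lt_of_le_of_lt ?_ hfin))
  refine iSup_le fun y => ?_
  rw [tsum_eq_sum (s := F) fun x hx => by simp [hk x y fun h => hx h.1]]
  by_cases hy : y ∈ F
  · exact Finset.single_le_sum (f := fun y => ∑ x ∈ F,
      ‖k (x, y)‖ₑ ^ 2 * ENNReal.ofReal ((1 + dist x y) ^ (2 * t))) (fun _ _ => zero_le) hy
  · rw [Finset.sum_eq_zero fun x _ => by simp [hk x y fun h => hy h.2]]
    exact zero_le

/-- Squared norms add up by Tonelli. The terms with n ≥ m ≥ t contribute at most 4^{-n} by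
monotonicity in t, and the finitely many others are finite. -/
theorem bsNorm_lt_top_of_enorm_sq_eq_tsum {k : ℕ → X × X → ℂ} {K : X × X → ℂ}
    (hfin : ∀ n (t : ℝ), bsNorm t (k n) < ∞) (hone : ∀ n : ℕ, bsNorm n (k n) ≤ 1)
    (hK : ∀ p, ‖K p‖ₑ ^ 2 = ∑' n, (4⁻¹ : ℝ≥0∞) ^ n * ‖k n p‖ₑ ^ 2) (t : ℝ) :
    bsNorm t K < ∞ := by
  obtain ⟨m, hm⟩ := exists_nat_ge t
  set S := (∑' n : ℕ, (4⁻¹ : ℝ≥0∞) ^ n) + ∑ n ∈ Finset.range m, bsNorm t (k n) ^ 2 with hS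
  have hSfin : S < ∞ := by
    refine ENNReal.add_lt_top.2 ⟨?_, ENNReal.sum_lt_top.2 fun n _ =>
      ENNReal.pow_lt_top (hfin n t)⟩
    rw [ENNReal.tsum_geometric, ENNReal.inv_lt_top, tsub_pos_iff_lt, ENNReal.inv_lt_one]
    norm_num
  have hterm : ∀ n, (4⁻¹ : ℝ≥0∞) ^ n * bsNorm t (k n) ^ 2 ≤
      (4⁻¹ : ℝ≥0∞) ^ n + if n ∈ Finset.range m then bsNorm t (k n) ^ 2 else 0 := by
    intro n
    by_cases hn : n ∈ Finset.range m
    · rw [if_pos hn]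
      refine le_add_left (mul_le_of_le_one_left' (pow_le_one₀ zero_le ?_))
      rw [ENNReal.inv_le_one]
      norm_num
    · rw [if_neg hn, add_zero]
      refine mul_le_of_le_one_right' (pow_le_one₀ zero_le ?_)
      have hmn : (m : ℝ) ≤ n := by exact_mod_cast not_lt.1 fun h => hn (Finset.mem_range.2 h)
      exact (bsNorm_mono (hm.trans hmn) _).trans (hone n)
  refine ENNReal.rpow_lt_top_of_nonneg (by norm_num) (ne_of_lt (lt_of_le_of_lt ?_ hSfin))
  refine iSup_le fun y => ?_
  calc ∑' x, ‖K (x, y)‖ₑ ^ 2 * ENNReal.ofReal ((1 + dist x y) ^ (2 * t))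
      = ∑' n, (4⁻¹ : ℝ≥0∞) ^ n *
          ∑' x, ‖k n (x, y)‖ₑ ^ 2 * ENNReal.ofReal ((1 + dist x y) ^ (2 * t)) := by
        simp only [hK, ← ENNReal.tsum_mul_left, ← ENNReal.tsum_mul_right, _root_.mul_assoc]
        exact ENNReal.tsum_comm
    _ ≤ ∑' n, (4⁻¹ : ℝ≥0∞) ^ n * bsNorm t (k n) ^ 2 := by
        refine ENNReal.tsum_le_tsum fun n => ?_
        gcongr
        exact bsNorm_le_iff.1 le_rfl y
    _ ≤ ∑' n, ((4⁻¹ : ℝ≥0∞) ^ n + if n ∈ Finset.range m then bsNorm t (k n) ^ 2 else 0) :=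
        ENNReal.tsum_le_tsum hterm
    _ = S := by
        rw [ENNReal.tsum_add, tsum_eq_sum (s := Finset.range m) fun n hn => if_neg hn, hS]
        congr 1
        exact Finset.sum_congr rfl fun n hn => if_pos hn

/-- A square function of a sequence of kernels. -/
theorem exists_kernel_enorm_sq_eq_tsum {X : Type u} {k : ℕ → X × X → ℂ} (hk : ∀ n p, ‖k n p‖ₑ ≤ 1) :
    ∃ K : X × X → ℂ, (∀ p, K p = (‖K p‖ : ℂ)) ∧
      ∀ p, ‖K p‖ₑ ^ 2 = ∑' n, (4⁻¹ : ℝ≥0∞) ^ n * ‖k n p‖ₑ ^ 2 := by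
  have hfin : ∀ p, ∑' n, (4⁻¹ : ℝ≥0∞) ^ n * ‖k n p‖ₑ ^ 2 < ∞ := by
    intro p
    refine lt_of_le_of_lt (ENNReal.tsum_le_tsum fun n =>
      mul_le_of_le_one_right' (pow_le_one₀ zero_le (hk n p))) ?_
    rw [ENNReal.tsum_geometric, ENNReal.inv_lt_top, tsub_pos_iff_lt, ENNReal.inv_lt_one]
    norm_num
  refine ⟨fun p => ((√(∑' n, (4⁻¹ : ℝ≥0∞) ^ n * ‖k n p‖ₑ ^ 2).toReal : ℝ) : ℂ),
    fun p => ?_, fun p => ?_⟩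
  · rw [Complex.norm_real, Real.norm_of_nonneg (Real.sqrt_nonneg _)]
  · rw [← ofReal_norm, Complex.norm_real, Real.norm_of_nonneg (Real.sqrt_nonneg _),
      ← ENNReal.ofReal_pow (Real.sqrt_nonneg _), Real.sq_sqrt ENNReal.toReal_nonneg,
      ENNReal.ofReal_toReal (hfin p).ne]

/-- The gliding hump. One n serves both as decay order and in the constant, so a failure gives a
single sequence of humps. The weight 4^{-n} in |K|² costs a factor 2^n in |k_n| ≤ 2^n K; violating
4^n leaves 2^n to spare. -/
theorem HasMRD.exists_matrixBound_of_le_one (hX : HasMRD X) :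
    ∃ n : ℕ, ∀ k : X × X → ℂ, bsStarNorm n k ≤ 1 → MatrixBound k (4 ^ n) := by
  classical
  by_contra! hcon
  simp only [MatrixBound, not_forall, not_le] at hcon
  choose k₀ hk₀ F a hF using hcon
  set k : ℕ → X × X → ℂ := fun n p => if p.1 ∈ F n ∧ p.2 ∈ F n then k₀ n p else 0 with hk
  have hk_le : ∀ n p, ‖k n p‖ₑ ≤ 1 * ‖k₀ n p‖ₑ := by
    intro n p
    rw [one_mul, hk]
    dsimp only
    split_ifs <;> simp
  have hone : ∀ n : ℕ, bsStarNorm n (k n) ≤ 1 := fun n =>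
    (bsStarNorm_le_mul (hk_le n)).trans (by simpa using hk₀ n)
  have hsupp : ∀ n x y, ¬(x ∈ F n ∧ y ∈ F n) → k n (x, y) = 0 := fun n x y h => if_neg h
  obtain ⟨K, hKpos, hK⟩ := exists_kernel_enorm_sq_eq_tsum (k := k) fun n p =>
    (enorm_le_bsNorm n.cast_nonneg (k n) p).trans ((le_max_left _ _).trans (hone n))
  have hKmem : K ∈ BS2 X := by
    intro t _
    refine max_lt ?_ ?_
    · exact bsNorm_lt_top_of_enorm_sq_eq_tsum
        (fun n => bsNorm_lt_top_of_finite_support (F n) (hsupp n))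
        (fun n => (le_max_left _ _).trans (hone n)) hK t
    · refine bsNorm_lt_top_of_enorm_sq_eq_tsum (k := fun n => kernelStar (k n))
        (fun n => bsNorm_lt_top_of_finite_support (F n) fun x y h => ?_)
        (fun n => (le_max_right _ _).trans (hone n)) (fun p => ?_) t
      · simp [kernelStar, hsupp n y x fun h' => h h'.symm]
      · simp only [enorm_kernelStar, hK]
  obtain ⟨T, -, hT⟩ := hX K hKmem
  have hTK := matrixBound_of_hasMatrix hT hKpos
  have hdom : ∀ n p, ‖k n p‖ₑ ≤ 2 ^ n * ‖K p‖ₑ := by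
    intro n p
    refine (ENNReal.pow_le_pow_left_iff two_ne_zero).1 ?_
    rw [mul_pow, hK, ← pow_mul, _root_.mul_comm n 2, pow_mul]
    calc ‖k n p‖ₑ ^ 2 = (2 ^ 2) ^ n * ((4⁻¹ : ℝ≥0∞) ^ n * ‖k n p‖ₑ ^ 2) := by
          rw [← _root_.mul_assoc, ← mul_pow]
          norm_num [ENNReal.mul_inv_cancel]
      _ ≤ _ := by
          gcongr
          exact ENNReal.le_tsum (f := fun n => (4⁻¹ : ℝ≥0∞) ^ n * ‖k n p‖ₑ ^ 2) n
  have hlt : ∀ n : ℕ, (2 : ℝ≥0∞) ^ n < ‖T‖ₑ := by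
    intro n
    have h1 := (hTK.of_le_mul (hdom n)) (F n) (a n)
    have h2 : ∑ x ∈ F n, (∑ y ∈ F n, ‖k n (x, y)‖ₑ * ‖a n y‖ₑ) ^ 2 =
        ∑ x ∈ F n, (∑ y ∈ F n, ‖k₀ n (x, y)‖ₑ * ‖a n y‖ₑ) ^ 2 := by
      refine Finset.sum_congr rfl fun x hx => ?_
      congr 1
      refine Finset.sum_congr rfl fun y hy => ?_
      simp [hk, hx, hy]
    rw [h2] at h1
    have h3 := (hF n).trans_le h1
    -- The common factor ∑ |a|² is cancelled.
    have h4 : ((4 : ℝ≥0∞) ^ n) ^ 2 < (2 ^ n * ‖T‖ₑ) ^ 2 := lt_of_mul_lt_mul_right' h3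
    have h5 : (4 : ℝ≥0∞) ^ n < 2 ^ n * ‖T‖ₑ := lt_of_not_ge fun h =>
      h4.not_ge (pow_le_pow_left' h 2)
    rw [show (4 : ℝ≥0∞) = 2 * 2 by norm_num, mul_pow] at h5
    exact lt_of_mul_lt_mul_left' h5
  obtain ⟨n, hn⟩ := ENNReal.exists_nat_gt (r := ‖T‖ₑ) enorm_ne_top
  refine absurd ((hlt n).trans hn) (not_lt.2 ?_)
  exact_mod_cast Nat.lt_two_pow_self.le

/-- Homogeneity: rescale by 1/s for s > ‖k‖_{BS*,n}, then let s decrease to the norm. The strict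
inequality avoids dividing by zero when the norm vanishes. -/
theorem HasMRD.exists_matrixBound (hX : HasMRD X) :
    ∃ n : ℕ, ∀ k : X × X → ℂ, MatrixBound k (4 ^ n * bsStarNorm n k) := by
  obtain ⟨n, hn⟩ := hX.exists_matrixBound_of_le_one
  refine ⟨n, fun k => ?_⟩
  have key : ∀ s : NNReal, bsStarNorm n k < s → MatrixBound k (s * 4 ^ n) := by
    intro s hs
    have hs0 : s ≠ 0 := by
      rintro rfl
      simp at hs
    have hsc : ((s⁻¹ : NNReal) : ℝ≥0∞) * s = 1 := by
      exact_mod_cast inv_mul_cancel₀ hs0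
    have hsnorm : ∀ p, ‖((s⁻¹ : NNReal) : ℂ) * k p‖ₑ = (s⁻¹ : NNReal) * ‖k p‖ₑ := by
      intro p
      rw [enorm_mul]
      congr 1
      rw [← ofReal_norm, Complex.norm_real, Real.norm_of_nonneg NNReal.zero_le_coe,
        ENNReal.ofReal_coe_nnreal]
    refine MatrixBound.of_le_mul (K := fun p => ((s⁻¹ : NNReal) : ℂ) * k p) (hn _ ?_) fun p => ?_
    · refine (bsStarNorm_le_mul (K := k) fun p => (hsnorm p).le).trans ?_
      rw [← hsc]
      gcongr
    · rw [hsnorm, ← _root_.mul_assoc, _root_.mul_comm (s : ℝ≥0∞), hsc, one_mul]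
  rcases eq_or_ne (bsStarNorm n k) ∞ with htop | htop
  · intro F a
    rw [htop, ENNReal.mul_top (by simp), ENNReal.top_pow two_ne_zero]
    -- Since ∞ · 0 = 0, the infinite bound says something when a vanishes on F.
    by_cases h0 : ∑ y ∈ F, ‖a y‖ₑ ^ 2 = 0
    · have ha : ∀ y ∈ F, a y = 0 := by simpa using h0
      rw [Finset.sum_eq_zero fun x _ => by
        rw [Finset.sum_eq_zero fun y hy => by simp [ha y hy]]
        simp]
      exact zero_le
    · rw [ENNReal.top_mul h0]
      exact le_top
  · intro F a
    lift bsStarNorm n k to NNReal using htop with b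
    have hlim : Tendsto (fun s : NNReal => ((s : ℝ≥0∞) * 4 ^ n) ^ 2 * ∑ y ∈ F, ‖a y‖ₑ ^ 2)
        (𝓝[>] b) (𝓝 (((b : ℝ≥0∞) * 4 ^ n) ^ 2 * ∑ y ∈ F, ‖a y‖ₑ ^ 2)) := by
      refine ENNReal.Tendsto.mul_const (ENNReal.Tendsto.pow (ENNReal.Tendsto.mul_const
        (ENNReal.tendsto_coe.2 (tendsto_id.mono_left nhdsWithin_le_nhds))
        (Or.inr (by simp)))) (Or.inr (by simp [ENNReal.sum_eq_top]))
    rw [_root_.mul_comm (4 ^ n : ℝ≥0∞)]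
    refine ge_of_tendsto hlim ?_
    filter_upwards [self_mem_nhdsWithin] with s hs
    exact key s (ENNReal.coe_lt_coe.2 hs) F a

end RapidDecay

/-! ### Finite sections of the regular representations of the coarse groupoid -/

/-- With the outer set F fixed, the inner sums are limits over finite F' ⊇ F, and enlarging the
outer set to F' only increases the sum. -/
theorem tsum_tsum_sq_le_of_finset {ι : Type u} {m : ι → ι → ℝ≥0∞} {B : ℝ≥0∞}
    (h : ∀ F : Finset ι, ∑ i ∈ F, (∑ j ∈ F, m i j) ^ 2 ≤ B) :
    ∑' i, (∑' j, m i j) ^ 2 ≤ B := by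
  refine ENNReal.summable.tsum_le_of_sum_le fun F => ?_
  have hlim : Tendsto (fun F' : Finset ι => ∑ i ∈ F, (∑ j ∈ F', m i j) ^ 2) atTop
      (𝓝 (∑ i ∈ F, (∑' j, m i j) ^ 2)) :=
    tendsto_finsetSum _ fun i _ => ENNReal.Tendsto.pow ENNReal.summable.hasSum
  refine le_of_tendsto hlim ?_
  filter_upwards [eventually_ge_atTop F] with F' hF'
  exact (Finset.sum_le_sum_of_subset hF').trans (h F')

namespace CoarseGroupoid

variable {X : Type u} [MetricSpace X]

theorem tendsto_ofPair (γ : CoarseGroupoid X) :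
    Tendsto (fun p : X × X => ofPair p.1 p.2) (γ.1 : Filter (X × X)) (𝓝 γ) := by
  rw [tendsto_subtype_rng]
  exact Ultrafilter.tendsto_pure_self γ.1

theorem ofPair_left_injective (y : X) : Function.Injective fun x : X => ofPair x y := by
  intro x x' h
  have h' : (pure (x, y) : Ultrafilter (X × X)) = pure (x', y) := congrArg Subtype.val h
  exact congrArg Prod.fst (Ultrafilter.pure_injective h')

variable [BoundedGeometry X]

/-- An arrow is determined by its source and a translation carrying it. -/
theorem val_eq_map_source {ω : CoarseGroupoid X} (γ : SourceFiber ω) :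
    γ.1.1 = ω.1.map fun p => (translation γ.1 p.2, p.2) := by
  obtain ⟨γ, rfl⟩ := γ
  change γ.1 = (γ.1.map fun p => (p.2, p.2)).map fun p => (translation γ p.2, p.2)
  rw [Ultrafilter.map_map]
  conv_lhs => rw [← Ultrafilter.map_id γ.1]
  refine ultrafilter_map_congr ?_
  filter_upwards [translation_spec γ] with p hp
  exact Prod.ext hp rfl

/-- This is (t_γ(y), y)(y, t_η(y)) = (t_γ(y), t_η(y)). All arrows γη⁻¹ are written over the single
ultrafilter ω, so finitely many of them can be sampled at one common y. -/
theorem mulInv_val {ω : CoarseGroupoid X} (γ η : SourceFiber ω) :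
    (mulInv γ η).1 = ω.1.map fun p => (translation γ.1 p.2, translation η.1 p.2) := by
  change ((η.1.1.map Prod.swap).map fun p => (translation γ.1 p.1, p.2)) = _
  rw [val_eq_map_source η, Ultrafilter.map_map, Ultrafilter.map_map]
  rfl

theorem tendsto_apply_ofPair_translation {f : CoarseGroupoid X → ℂ} (hf : Continuous f)
    {ω : CoarseGroupoid X} (γ η : SourceFiber ω) :
    Tendsto (fun p : X × X => f (ofPair (translation γ.1 p.2) (translation η.1 p.2)))
      (ω.1 : Filter (X × X)) (𝓝 (f (mulInv γ η))) := by
  have h := (hf.tendsto _).comp (tendsto_ofPair (mulInv γ η))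
  rw [mulInv_val] at h
  exact tendsto_map'_iff.1 h

/-- Otherwise, ω being an ultrafilter, the two translations agree ω-almost everywhere, and they
determine the arrows. -/
theorem eventually_translation_ne {ω : CoarseGroupoid X} {γ η : SourceFiber ω} (h : γ ≠ η) :
    ∀ᶠ p in (ω.1 : Filter (X × X)), translation γ.1 p.2 ≠ translation η.1 p.2 := by
  refine Ultrafilter.eventually_not.2 fun heq => h (Subtype.ext (Subtype.ext ?_))
  rw [val_eq_map_source γ, val_eq_map_source η]
  refine ultrafilter_map_congr ?_
  filter_upwards [heq] with p hp
  rw [hp]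

theorem sum_mulInv_le {f : CoarseGroupoid X → ℂ} (hf : Continuous f) {B : ℝ≥0∞}
    (hB : MatrixBound (fun p : X × X => f (ofPair p.1 p.2)) B) {ω : CoarseGroupoid X}
    (ξ : SourceFiber ω → ℂ) (F : Finset (SourceFiber ω)) :
    ∑ γ ∈ F, (∑ η ∈ F, ‖f (mulInv γ η)‖ₑ * ‖ξ η‖ₑ) ^ 2 ≤ B ^ 2 * ∑ η ∈ F, ‖ξ η‖ₑ ^ 2 := by
  have hlim : Tendsto (fun p : X × X => ∑ γ ∈ F, (∑ η ∈ F,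
      ‖f (ofPair (translation γ.1 p.2) (translation η.1 p.2))‖ₑ * ‖ξ η‖ₑ) ^ 2)
      (ω.1 : Filter (X × X)) (𝓝 (∑ γ ∈ F, (∑ η ∈ F, ‖f (mulInv γ η)‖ₑ * ‖ξ η‖ₑ) ^ 2)) :=
    tendsto_finsetSum _ fun γ _ => ENNReal.Tendsto.pow <| tendsto_finsetSum _ fun η _ =>
      ENNReal.Tendsto.mul_const (tendsto_apply_ofPair_translation hf γ η).enorm
        (Or.inr enorm_ne_top)
  have hinj : ∀ᶠ p in (ω.1 : Filter (X × X)),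
      Set.InjOn (fun γ : SourceFiber ω => translation γ.1 p.2) F := by
    have h : ∀ᶠ p in (ω.1 : Filter (X × X)), ∀ γ ∈ F, ∀ η ∈ F, γ ≠ η →
        translation γ.1 p.2 ≠ translation η.1 p.2 := by
      refine (Filter.eventually_all_finset F).2 fun γ _ =>
        (Filter.eventually_all_finset F).2 fun η _ => ?_
      by_cases hne : γ = η
      · exact Filter.Eventually.of_forall fun p h => absurd hne h
      · filter_upwards [eventually_translation_ne hne] with p hp _ using hp
    filter_upwards [h] with p hp γ hγ η hη heq
    by_contra hne
    exact hp γ hγ η hη hne heq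
  -- The inequality is closed, so it suffices to have it at ω-almost every p, where the reindexing
  -- by translations is injective.
  refine le_of_tendsto hlim ?_
  filter_upwards [hinj] with p hp
  exact hB.sum_comp_le F _ hp ξ

theorem reducedNorm_le {f : CoarseGroupoid X → ℂ} (hf : Continuous f) {B : ℝ≥0∞}
    (hB : MatrixBound (fun p : X × X => f (ofPair p.1 p.2)) B) : reducedNorm f ≤ B := by
  refine iSup₂_le fun ω _ => iSup₂_le fun ξ hξ => ?_
  rw [l2norm, one_div, ENNReal.rpow_inv_le_iff two_pos, ENNReal.rpow_two]
  have hξ' : ∑' η, ‖ξ η‖ₑ ^ 2 ≤ 1 := by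
    rw [tsum_enorm_sq_lp]
    refine pow_le_one₀ zero_le ?_
    rw [← ofReal_norm]
    exact ENNReal.ofReal_le_one.2 hξ
  calc ∑' γ, ‖leftRegular f ω ξ γ‖ₑ ^ 2
      ≤ ∑' γ : SourceFiber ω, (∑' η, ‖f (mulInv γ η)‖ₑ * ‖ξ η‖ₑ) ^ 2 := by
        refine ENNReal.tsum_le_tsum fun γ => ?_
        gcongr
        -- No summability is needed: a divergent series has the value 0.
        refine enorm_tsum_le_tsum_enorm.trans_eq ?_
        simp only [enorm_mul]
    _ ≤ B ^ 2 * ∑' η, ‖ξ η‖ₑ ^ 2 := by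
        refine tsum_tsum_sq_le_of_finset fun F => (sum_mulInv_le hf hB _ F).trans ?_
        gcongr
        exact ENNReal.sum_le_tsum F
    _ ≤ B ^ 2 := mul_le_of_le_one_right' hξ'

/-- The source fibre at the principal unit (y,y) contains the pairs (x,y), whose lengths are d(x,y).
-/
theorem bsNorm_le_sourceNorm (f : CoarseGroupoid X → ℂ) (t : ℝ) :
    bsNorm t (fun p : X × X => f (ofPair p.1 p.2)) ≤ sourceNorm (canonicalLength X) t f := by
  rw [bsNorm_le_iff]
  intro y
  have hy : ofPair y y ∈ unitSpace (CoarseGroupoid X) := ⟨ofPair y y, rfl⟩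
  have h : fiberNorm (canonicalLength X) t f (ofPair y y) ≤ sourceNorm (canonicalLength X) t f :=
    le_iSup₂_of_le _ hy le_rfl
  rw [fiberNorm, one_div, ENNReal.rpow_inv_le_iff two_pos, ENNReal.rpow_two] at h
  refine le_trans ?_ h
  let e : X → SourceFiber (ofPair y y) := fun x => ⟨ofPair x y, rfl⟩
  have he : Function.Injective e := fun x x' hxx =>
    ofPair_left_injective y (congrArg Subtype.val hxx)
  refine le_trans (le_of_eq ?_) (ENNReal.tsum_comp_le_tsum_of_injective he _)
  refine tsum_congr fun x => ?_
  change _ = ‖f (ofPair x y)‖ₑ ^ 2 * ENNReal.ofReal ((1 + len (ofPair x y)) ^ (2 * t))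
  rw [len_ofPair]

theorem bsStarNorm_le_lengthNorm (f : CoarseGroupoid X → ℂ) (t : ℝ) :
    bsStarNorm t (fun p : X × X => f (ofPair p.1 p.2)) ≤ lengthNorm (canonicalLength X) t f :=
  -- Restriction to X × X turns `involution` into `kernelStar` definitionally.
  max_le_max (bsNorm_le_sourceNorm f t) (bsNorm_le_sourceNorm (involution f) t)

end CoarseGroupoid

end CoarseRD

theorem lemma3p5 (X : Type*) [MetricSpace X] [CoarseRD.BoundedGeometry X]
    (hX : CoarseRD.HasMRD X) :
    CoarseRD.HasRD (CoarseRD.CoarseGroupoid.canonicalLength X) := by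
  obtain ⟨n, hn⟩ := hX.exists_matrixBound
  refine ⟨4 ^ n, n, by positivity, n.cast_nonneg, fun f => ?_⟩
  refine (CoarseRD.CoarseGroupoid.reducedNorm_le f.continuous (hn _)).trans ?_
  rw [ENNReal.ofReal_pow (by norm_num), ENNReal.ofReal_ofNat]
  gcongr
  exact CoarseRD.CoarseGroupoid.bsStarNorm_le_lengthNorm f n
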